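/- A lattice polygon is the convex hull in $\mathbb{R}^2$ of a nonempty finite set of points of $\mathbb{Z}^2$ (segments and points are allowed). Two lattice polygons $P,Q$ are lattice equivalent if $Q=MP+v$ for some $M\in \mathrm{GL}(2,\mathbb{Z})$ and $v\in\mathbb{Z}^2$. For a lattice polygon $P$ and a finite field $\mathbb{F}_q$, the toric code $C_P(\mathbb{F}_q)\subseteq \mathbb{F}_q^{(q-1)^2}$ is the span of the vectors $(a_1^{p_1}a_2^{p_2})_{a\in(\mathbb{F}_q^*)^2}$ for $p\in P\cap\mathbb{Z}^2$; a toric surface code over $\mathbb{F}_q$ is a code $C_P(\mathbb{F}_q)$ with $P\subseteq[0,q-2]^2$. Two codes are monomially equivalent if they have generator matrices $G_1,G_2$ of the same size with $G_2=G_1\Delta\Pi$, where $\Delta$ is an invertible diagonal matrix and $\Pi$ is a permutation matrix. **Theorem.** There are exactly $42$ lattice-equivalence classes of lattice polygons with exactly $8$ lattice points (interior or boundary). Moreover these classes have representatives $P_1,\dots,P_{42}$, and there is a $q_0$, such that for every finite field $\mathbb{F}_q$ with $q\ge q_0$ all $P_i$ lie in $[0,q-2]^2$ and every toric surface code of dimension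 $8$ over $\mathbb{F}_q$ is monomially equivalent to $C_{P_i}(\mathbb{F}_q)$ for some $i\in\{1,\dots,42\}$. -/

import Mathlib

namespace ToricSurface

/-- A lattice point, viewed as a point of the real plane. -/
def latticePt (p : Fin 2 → ℤ) : Fin 2 → ℝ := fun i => (p i : ℝ)

/-- Lattice polygons: convex hulls of nonempty finite sets of lattice points of the plane
(segments and single points are allowed). -/
def IsLatticePolygon (P : Set (Fin 2 → ℝ)) : Prop :=
  ∃ S : Finset (Fin 2 → ℤ), S.Nonempty ∧
    P = convexHull ℝ (latticePt '' (S : Set (Fin 2 → ℤ)))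

/-- The lattice points lying in `P` (in the interior or on the boundary). -/
def latticePoints (P : Set (Fin 2 → ℝ)) : Set (Fin 2 → ℤ) := {p | latticePt p ∈ P}

/-- The square `[0, q - 2]²`. -/
def box (q : ℕ) : Set (Fin 2 → ℝ) := {x | ∀ i, 0 ≤ x i ∧ x i ≤ (q : ℝ) - 2}

/-- `Q` is the image of `P` under `x ↦ M x + v` with `M ∈ GL(2, ℤ)` and `v ∈ ℤ²`. -/
def LatticeEquivalent (P Q : Set (Fin 2 → ℝ)) : Prop :=
  ∃ (M : GL (Fin 2) ℤ) (v : Fin 2 → ℤ),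
    (fun x : Fin 2 → ℝ =>
      ((M : Matrix (Fin 2) (Fin 2) ℤ).map (Int.cast : ℤ → ℝ)).mulVec x + latticePt v) '' P = Q

/-- The evaluation vector `(a ^ p : a ∈ (Fˣ)²)` of the monomial with exponent vector `p`. -/
def evalMonomial (F : Type*) [Field F] (p : Fin 2 → ℤ) : (Fin 2 → Fˣ) → F :=
  fun a => ((∏ i, a i ^ p i : Fˣ) : F)

/-- The code `C_P(F)`: the span of the evaluation vectors of the monomials with exponent
vector in `P ∩ ℤ²`. -/
def toricCode (F : Type*) [Field F] (P : Set (Fin 2 → ℝ)) : Submodule F ((Fin 2 → Fˣ) → F) :=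
  Submodule.span F (evalMonomial F '' latticePoints P)

/-- A toric surface code over the finite field `F` with `q` elements is the code of a lattice
polygon contained in `[0, q - 2]²`. -/
def IsToricSurfaceCode (F : Type*) [Field F] [Fintype F]
    (C : Submodule F ((Fin 2 → Fˣ) → F)) : Prop :=
  ∃ P : Set (Fin 2 → ℝ), IsLatticePolygon P ∧ P ⊆ box (Fintype.card F) ∧ C = toricCode F P

/-- The rows of `G` form a basis of the code `C`. -/
def IsGeneratorMatrix {F : Type*} [Field F] {ι : Type*} {k : ℕ}
    (G : Matrix (Fin k) ι F) (C : Submodule F (ι → F)) : Prop :=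
  LinearIndependent F G.row ∧ Submodule.span F (Set.range G.row) = C

/-- `C₁` and `C₂` have generator matrices with `G₂ = G₁ Δ Π`, where `Δ` is an invertible
diagonal matrix and `Π` is a permutation matrix. -/
def MonomiallyEquivalent {F : Type*} [Field F] {ι : Type*} [Fintype ι] [DecidableEq ι]
    (C₁ C₂ : Submodule F (ι → F)) : Prop :=
  ∃ (k : ℕ) (G₁ G₂ : Matrix (Fin k) ι F) (d : ι → Fˣ) (σ : Equiv.Perm ι),
    IsGeneratorMatrix G₁ C₁ ∧ IsGeneratorMatrix G₂ C₂ ∧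
      G₂ = G₁ * Matrix.diagonal (fun j => (d j : F)) * σ.permMatrix F

end ToricSurface

/-! The lattice points of a polygon form a set closed under triangles, and the polygon is their
hull, so finite sets in `ℤ × ℤ` can be classified up to affine unimodular maps. Collinear sets are
segments. The others are built by induction on the number of points, starting from the unimodular
triangle: deleting a suitable lexicographic extreme point leaves a smaller closed, noncollinear set
(`TriClosed.exists_erase`). Conversely, an added point lies at height at least `-1` over every
primitive edge, because a deeper point would force a further lattice point at height `-1`
(`TriClosed.exists_area_eq_neg_one`). These inequalities leave finitely many extensions of each
listed set, and stored codes identify each extension with a set in the next list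
(`Classifies.succ`). This gives 41 two-dimensional classes and one segment; an invariant built from
triangle areas separates all 42.

For codes, monomials with exponents in `[0, q - 2]²` are distinct characters of the torus, hence
independent, so the dimension counts lattice points (`finrank_toricCode`). A unimodular matrix
permutes the torus and a translation rescales coordinates, so lattice equivalence yields monomial
equivalence (`LatticeEquivalent.monomiallyEquivalent`). -/

namespace ToricSurface

/-! ### Unimodular maps and triangle-closed sets of lattice points. -/

/-- Twice the signed area of the triangle with vertices `a`, `b`, `c`. -/
def area (a b c : ℤ × ℤ) : ℤ :=
  (b.1 - a.1) * (c.2 - a.2) - (b.2 - a.2) * (c.1 - a.1)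

/-- Affine unimodular maps of the lattice `ℤ × ℤ`. -/
def UniAff (f : ℤ × ℤ → ℤ × ℤ) : Prop :=
  ∃ a b c d e g : ℤ, (a * d - b * c = 1 ∨ a * d - b * c = -1) ∧
    ∀ p, f p = (a * p.1 + b * p.2 + e, c * p.1 + d * p.2 + g)

/-- `S` contains every lattice point which lies in a triangle with vertices in `S`. -/
def TriClosed (S : Finset (ℤ × ℤ)) : Prop :=
  ∀ p ∈ S, ∀ q ∈ S, ∀ r ∈ S, ∀ (x : ℤ × ℤ) (α β γ : ℤ), 0 ≤ α → 0 ≤ β → 0 ≤ γ →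
    0 < α + β + γ → (α + β + γ) * x.1 = α * p.1 + β * q.1 + γ * r.1 →
    (α + β + γ) * x.2 = α * p.2 + β * q.2 + γ * r.2 → x ∈ S

/-- Equivalence of finite sets of lattice points under affine unimodular maps. -/
def UniEquiv (S T : Finset (ℤ × ℤ)) : Prop := ∃ f, UniAff f ∧ S.image f = T

/-- `S` is contained in a line. -/
def CollinearPts (S : Finset (ℤ × ℤ)) : Prop :=
  ∀ p ∈ S, ∀ q ∈ S, ∀ r ∈ S, area p q r = 0

theorem UniAff.comp {f g : ℤ × ℤ → ℤ × ℤ} (hf : UniAff f) (hg : UniAff g) : UniAff (f ∘ g) := by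
  obtain ⟨a, b, c, d, e, k, h, hf⟩ := hf
  obtain ⟨a', b', c', d', e', k', h', hg⟩ := hg
  refine ⟨a * a' + b * c', a * b' + b * d', c * a' + d * c', c * b' + d * d',
    a * e' + b * k' + e, c * e' + d * k' + k, ?_, fun p => ?_⟩
  · have : (a * a' + b * c') * (c * b' + d * d') - (a * b' + b * d') * (c * a' + d * c') =
      (a * d - b * c) * (a' * d' - b' * c') := by ring
    rw [this]
    rcases h with h | h <;> rcases h' with h' | h' <;> simp [h, h']
  · simp only [Function.comp, hg, hf]
    ext <;> simp <;> ring

theorem UniAff.exists_inverse {f : ℤ × ℤ → ℤ × ℤ} (hf : UniAff f) :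
    ∃ g, UniAff g ∧ Function.LeftInverse g f ∧ Function.RightInverse g f := by
  obtain ⟨a, b, c, d, e, k, h, hf⟩ := hf
  obtain ⟨δ, hδ, hδ'⟩ : ∃ δ : ℤ, δ = a * d - b * c ∧ δ * δ = 1 := by
    refine ⟨_, rfl, ?_⟩
    rcases h with h | h <;> simp [h]
  have key : δ * (a * d - b * c) = 1 := hδ ▸ hδ'
  refine ⟨fun p => (δ * d * p.1 + (-(δ * b)) * p.2 + δ * (b * k - d * e),
    (-(δ * c)) * p.1 + δ * a * p.2 + δ * (c * e - a * k)),
    ⟨_, _, _, _, _, _, ?_, fun p => rfl⟩, fun p => ?_, fun p => ?_⟩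
  · have : δ * d * (δ * a) - -(δ * b) * -(δ * c) = δ * δ * (a * d - b * c) := by ring
    rw [this, hδ']
    simpa using h
  · simp only [hf]
    ext
    · linear_combination p.1 * key
    · linear_combination p.2 * key
  · simp only [hf]
    ext
    · linear_combination (p.1 - e) * key
    · linear_combination (p.2 - k) * key

theorem UniAff.injective {f : ℤ × ℤ → ℤ × ℤ} (hf : UniAff f) : Function.Injective f :=
  let ⟨_, _, h, _⟩ := hf.exists_inverse
  h.injective

theorem UniAff.area_eq {f : ℤ × ℤ → ℤ × ℤ} (hf : UniAff f) :
    ∃ δ : ℤ, (δ = 1 ∨ δ = -1) ∧ ∀ p q r, area (f p) (f q) (f r) = δ * area p q r := by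
  obtain ⟨a, b, c, d, e, k, h, hf⟩ := hf
  refine ⟨_, h, fun p q r => ?_⟩
  simp only [hf, area]
  ring

theorem UniEquiv.symm {S T : Finset (ℤ × ℤ)} (h : UniEquiv S T) : UniEquiv T S := by
  obtain ⟨f, hf, rfl⟩ := h
  obtain ⟨g, hg, hl, -⟩ := hf.exists_inverse
  refine ⟨g, hg, ?_⟩
  rw [Finset.image_image, hl.comp_eq_id, Finset.image_id]

theorem UniEquiv.trans {S T U : Finset (ℤ × ℤ)} (h : UniEquiv S T) (h' : UniEquiv T U) :
    UniEquiv S U := by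
  obtain ⟨f, hf, rfl⟩ := h
  obtain ⟨g, hg, rfl⟩ := h'
  exact ⟨g ∘ f, hg.comp hf, by rw [Finset.image_image]⟩

theorem TriClosed.image {S : Finset (ℤ × ℤ)} (hS : TriClosed S) {f : ℤ × ℤ → ℤ × ℤ}
    (hf : UniAff f) : TriClosed (S.image f) := by
  obtain ⟨g, ⟨a, b, c, d, e, k, -, hg⟩, hl, hr⟩ := hf.exists_inverse
  have mem : ∀ y, y ∈ S.image f ↔ g y ∈ S := fun y => by
    rw [Finset.mem_image]
    exact ⟨fun ⟨z, hz, h⟩ => by rw [← h, hl]; exact hz, fun h => ⟨_, h, hr y⟩⟩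
  intro p hp q hq r hr x α β γ hα hβ hγ h h1 h2
  rw [mem] at hp hq hr ⊢
  refine hS _ hp _ hq _ hr _ α β γ hα hβ hγ h ?_ ?_
  · simp only [hg]
    linear_combination a * h1 + b * h2
  · simp only [hg]
    linear_combination c * h1 + d * h2

/-- A triangle with a primitive edge and height at least two has a lattice point at height one. -/
theorem TriClosed.exists_area_eq_neg_one {S : Finset (ℤ × ℤ)} (hS : TriClosed S)
    {a b v : ℤ × ℤ} (ha : a ∈ S) (hb : b ∈ S) (hv : v ∈ S)
    (hab : Int.gcd (b.1 - a.1) (b.2 - a.2) = 1) (h : area a b v ≤ -2) :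
    ∃ w ∈ S, area a b w = -1 := by
  obtain ⟨s, t, hst⟩ := Int.isCoprime_iff_gcd_eq_one.2 hab
  obtain ⟨D, hD⟩ : ∃ D, D = -area a b v := ⟨_, rfl⟩
  -- With `u = b - a`, Bézout gives `v - a = p u + D (t, -s)`. Taking `m ≡ -p` modulo `D` makes `v +
  -- m b + (D - 1 - m) a` divisible by `D`; the quotient has height `-1`.
  obtain ⟨p, hp⟩ : ∃ p, p = (v.1 - a.1) * s + (v.2 - a.2) * t := ⟨_, rfl⟩
  have hdiv := Int.emod_add_mul_ediv (-p) D
  have h0 := Int.emod_nonneg (-p) (show D ≠ 0 by omega)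
  have h1 := Int.emod_lt_of_pos (-p) (show 0 < D by omega)
  generalize (-p) % D = m at *
  generalize (-p) / D = k at *
  rw [area] at hD
  refine ⟨(a.1 - k * (b.1 - a.1) + t, a.2 - k * (b.2 - a.2) - s),
    hS v hv b hb a ha _ 1 m (D - 1 - m) (by omega) (by omega) (by omega) (by omega) ?_ ?_, ?_⟩
  · simp only
    linear_combination (-(b.1 - a.1)) * hdiv + (b.1 - a.1) * hp + (v.1 - a.1) * hst + t * hD
  · simp only
    linear_combination (-(b.2 - a.2)) * hdiv + (b.2 - a.2) * hp + (v.2 - a.2) * hst - s * hD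
  · simp only [area]
    linear_combination -hst

/-- A set closed under triangles contains two points at primitive distance on every line
through two of its points. -/
theorem TriClosed.exists_primitive {S : Finset (ℤ × ℤ)} (hS : TriClosed S)
    {p q : ℤ × ℤ} (hp : p ∈ S) (hq : q ∈ S) (hpq : p ≠ q) :
    ∃ q' ∈ S, ∃ g : ℤ, 0 < g ∧ Int.gcd (q'.1 - p.1) (q'.2 - p.2) = 1 ∧
      q.1 - p.1 = g * (q'.1 - p.1) ∧ q.2 - p.2 = g * (q'.2 - p.2) := by
  have hg : 0 < Int.gcd (q.1 - p.1) (q.2 - p.2) := by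
    rw [Nat.pos_iff_ne_zero, Ne, Int.gcd_eq_zero_iff]
    rintro ⟨h1, h2⟩
    exact hpq (Prod.ext (by omega) (by omega))
  have h1 := Int.mul_ediv_cancel' (Int.gcd_dvd_left (q.1 - p.1) (q.2 - p.2))
  have h2 := Int.mul_ediv_cancel' (Int.gcd_dvd_right (q.1 - p.1) (q.2 - p.2))
  have h3 := Int.gcd_ediv_gcd_ediv_gcd hg
  generalize Int.gcd (q.1 - p.1) (q.2 - p.2) = g at *
  generalize (q.1 - p.1) / (g : ℤ) = u at *
  generalize (q.2 - p.2) / (g : ℤ) = w at *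
  refine ⟨(p.1 + u, p.2 + w), hS q hq p hp p hp _ 1 (g - 1) 0 (by omega) (by omega) (by omega)
    (by omega) ?_ ?_, g, by omega, by simpa using h3, ?_, ?_⟩
  · simp only
    linear_combination h1
  · simp only
    linear_combination h2
  · simp [← h1]
  · simp [← h2]

/-- Removing a lexicographically extreme point keeps a set closed under triangles. -/
theorem TriClosed.erase {S : Finset (ℤ × ℤ)} (hS : TriClosed S) {v : ℤ × ℤ} {s : ℤ}
    (h : ∀ p ∈ S, p ≠ v → 0 < s * (v.1 - p.1) ∨ v.1 = p.1 ∧ 0 < s * (v.2 - p.2)) :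
    TriClosed (S.erase v) := by
  intro p hp q hq r hr x α β γ hα hβ hγ hpos h1 h2
  rw [Finset.mem_erase] at hp hq hr ⊢
  refine ⟨?_, hS p hp.2 q hq.2 r hr.2 x α β γ hα hβ hγ hpos h1 h2⟩
  rintro rfl
  have hx : ∀ p ∈ S, p ≠ x → 0 ≤ s * (x.1 - p.1) := fun p hp hpx => by
    rcases h p hp hpx with h | h
    · exact h.le
    · simp [h.1]
  have ep := mul_nonneg hα (hx p hp.2 hp.1)
  have eq := mul_nonneg hβ (hx q hq.2 hq.1)
  have er := mul_nonneg hγ (hx r hr.2 hr.1)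
  -- The first coordinates give nonnegative terms with sum zero, so each vanishes. Every vertex of
  -- positive weight then ties with `x` there and is strictly separated by the second coordinate.
  have e : α * (s * (x.1 - p.1)) + β * (s * (x.1 - q.1)) + γ * (s * (x.1 - r.1)) = 0 := by
    linear_combination s * h1
  have key : ∀ (p : ℤ × ℤ) (α : ℤ), p ∈ S → p ≠ x → 0 ≤ α → α * (s * (x.1 - p.1)) = 0 →
      α = 0 ∨ 0 < α * (s * (x.2 - p.2)) := fun p α hp hpx hα hz => by
    rcases hα.eq_or_lt with h0 | h0
    · exact Or.inl h0.symm
    rcases h p hp hpx with h | h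
    · exact absurd hz (mul_pos h0 h).ne'
    · exact Or.inr (mul_pos h0 h.2)
  have e' : α * (s * (x.2 - p.2)) + β * (s * (x.2 - q.2)) + γ * (s * (x.2 - r.2)) = 0 := by
    linear_combination s * h2
  rcases key p α hp.2 hp.1 hα (by omega) with kp | kp <;>
  rcases key q β hq.2 hq.1 hβ (by omega) with kq | kq <;>
  rcases key r γ hr.2 hr.1 hγ (by omega) with kr | kr <;>
  first | omega | (simp only [kp, kq, kr, zero_mul] at e' hpos; omega)

theorem area_eq_zero_of_collinear {m₁ m₂ p q r : ℤ × ℤ} (hm : m₁ ≠ m₂) (hp : area m₁ m₂ p = 0)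
    (hq : area m₁ m₂ q = 0) (hr : area m₁ m₂ r = 0) : area p q r = 0 := by
  have h1 : (m₂.1 - m₁.1) * area p q r = 0 := by
    simp only [area] at *
    linear_combination (q.1 - p.1) * hr + (r.1 - q.1) * hp + (p.1 - r.1) * hq
  have h2 : (m₂.2 - m₁.2) * area p q r = 0 := by
    simp only [area] at *
    linear_combination (q.2 - p.2) * hr + (r.2 - q.2) * hp + (p.2 - r.2) * hq
  by_contra h
  refine hm (Prod.ext ?_ ?_)
  · have := (mul_eq_zero.1 h1).resolve_right h
    omega
  · have := (mul_eq_zero.1 h2).resolve_right h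
    omega

/-- A set closed under triangles, with at least four points and not contained in a line, has a
point whose removal keeps these two properties. -/
theorem TriClosed.exists_erase {S : Finset (ℤ × ℤ)} (hS : TriClosed S) (hc : ¬ CollinearPts S)
    (h4 : 4 ≤ S.card) : ∃ v ∈ S, TriClosed (S.erase v) ∧ ¬ CollinearPts (S.erase v) := by
  have hne : S.Nonempty := Finset.card_pos.1 (by omega)
  obtain ⟨v, hv, hmax⟩ := S.exists_max_image toLex hne
  obtain ⟨w, hw, hmin⟩ := S.exists_min_image toLex hne
  have hvc : TriClosed (S.erase v) := hS.erase (s := 1) fun p hp hpv => by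
    rcases Prod.Lex.toLex_le_toLex.1 (hmax p hp) with h | h
    · left; omega
    · right
      refine ⟨h.1.symm, ?_⟩
      have : p.2 ≠ v.2 := fun h' => hpv (Prod.ext h.1 h')
      omega
  have hwc : TriClosed (S.erase w) := hS.erase (s := -1) fun p hp hpv => by
    rcases Prod.Lex.toLex_le_toLex.1 (hmin p hp) with h | h
    · left; omega
    · right
      refine ⟨h.1, ?_⟩
      have : p.2 ≠ w.2 := fun h' => hpv (Prod.ext h.1.symm h')
      omega
  by_contra! hcon
  have cv := hcon v hv hvc
  have cw := hcon w hw hwc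
  -- If both deletions were collinear, two points other than `v` and `w` would span a line
  -- containing all of `S`; four points are needed to have two left.
  have hcard : 1 < ((S.erase v).erase w).card := by
    have h1 := Finset.pred_card_le_card_erase (s := S) (a := v)
    have h2 := Finset.pred_card_le_card_erase (s := S.erase v) (a := w)
    omega
  obtain ⟨m₁, hm₁, m₂, hm₂, hm⟩ := Finset.one_lt_card.1 hcard
  simp only [Finset.mem_erase] at hm₁ hm₂
  have hall : ∀ p ∈ S, area m₁ m₂ p = 0 := fun p hp => by
    by_cases hpv : p = v
    · by_cases hpw : p = w
      · exfalso
        subst hpv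
        have hle := (hmax m₁ hm₁.2.2).antisymm (by rw [hpw]; exact hmin m₁ hm₁.2.2)
        exact hm₁.2.1 (toLex.injective hle)
      · exact cw _ (by simp [hm₁]) _ (by simp [hm₂]) _ (by simp [hpw, hp])
    · exact cv _ (by simp [hm₁]) _ (by simp [hm₂]) _ (by simp [hpv, hp])
  exact hc fun p hp q hq r hr => area_eq_zero_of_collinear hm (hall p hp) (hall q hq) (hall r hr)

/-- Collinear sets closed under triangles are equivalent to lattice segments. -/
theorem TriClosed.uniEquiv_segment {S : Finset (ℤ × ℤ)} (hS : TriClosed S)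
    (hc : CollinearPts S) {n : ℕ} (hn : S.card = n + 2) :
    UniEquiv S ((Finset.range (n + 2)).image fun i : ℕ => ((i : ℤ), (0 : ℤ))) := by
  obtain ⟨p, hp, q, hq, hpq⟩ := Finset.one_lt_card.1 (show 1 < S.card by omega)
  obtain ⟨q', hq', g, hg, hgcd, -, -⟩ := hS.exists_primitive hp hq hpq
  obtain ⟨s, t, hst⟩ := Int.isCoprime_iff_gcd_eq_one.2 hgcd
  -- The second coordinate of `φ x` is `area p q' x`, so the line goes to the horizontal axis; the
  -- Bézout row makes `φ` unimodular.
  set φ : ℤ × ℤ → ℤ × ℤ := fun x =>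
    (s * x.1 + t * x.2 + 0, (-(q'.2 - p.2)) * x.1 + (q'.1 - p.1) * x.2 +
      ((q'.2 - p.2) * p.1 - (q'.1 - p.1) * p.2)) with hφ
  have hu : UniAff φ := ⟨_, _, _, _, _, _, Or.inl (by linear_combination hst), fun x => rfl⟩
  have hT := hS.image hu
  have hline : ∀ x ∈ S.image φ, x.2 = 0 := fun x hx => by
    obtain ⟨y, hy, rfl⟩ := Finset.mem_image.1 hx
    have := hc p hp q' hq' y hy
    simp only [area] at this
    simp only [hφ]
    linear_combination this
  have hTcard : (S.image φ).card = n + 2 := by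
    rw [Finset.card_image_of_injective _ hu.injective, hn]
  refine UniEquiv.trans ⟨φ, hu, rfl⟩ ?_
  generalize S.image φ = T at *
  have hne : T.Nonempty := Finset.card_pos.1 (by omega)
  obtain ⟨u, hu, hmin⟩ := T.exists_min_image Prod.fst hne
  obtain ⟨w, hw, hmax⟩ := T.exists_max_image Prod.fst hne
  have hTeq : T = (Finset.Icc u.1 w.1).image fun i : ℤ => (i, (0 : ℤ)) := by
    ext x
    simp only [Finset.mem_image, Finset.mem_Icc]
    constructor
    · exact fun hx => ⟨x.1, ⟨hmin x hx, hmax x hx⟩, Prod.ext rfl (hline x hx).symm⟩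
    · rintro ⟨i, ⟨h1, h2⟩, rfl⟩
      rcases h1.eq_or_lt with h | h
      · convert hu using 1
        exact Prod.ext h.symm (hline u hu).symm
      · refine hT w hw u hu u hu _ (i - u.1) (w.1 - i) 0 (by omega) (by omega) (by omega)
          (by omega) ?_ ?_
        · simp only
          ring
        · simp [hline u hu, hline w hw]
  have hlen : w.1 + 1 - u.1 = n + 2 := by
    have hle := hmin w hw
    rw [hTeq, Finset.card_image_of_injective _ (fun i j h => (Prod.ext_iff.1 h).1),
      Int.card_Icc] at hTcard
    omega
  refine ⟨fun x => (1 * x.1 + 0 * x.2 + (-u.1), 0 * x.1 + 1 * x.2 + 0),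
    ⟨_, _, _, _, _, _, Or.inl (by norm_num), fun x => rfl⟩, ?_⟩
  rw [hTeq, Finset.image_image]
  ext x
  simp only [Finset.mem_image, Finset.mem_Icc, Finset.mem_range, Function.comp]
  constructor
  · rintro ⟨i, hi, rfl⟩
    exact ⟨(i - u.1).toNat, by omega, by ext <;> simp; omega⟩
  · rintro ⟨i, hi, rfl⟩
    exact ⟨i + u.1, by omega, by ext <;> simp⟩

/-! ### Computable certificates in natural coordinates. -/

/-- A point with natural coordinates as a point of `ℤ × ℤ`. -/
def toZ (p : ℕ × ℕ) : ℤ × ℤ := (p.1, p.2)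

/-- The positive part of the expansion of `area a b c`; the negative part is `cyc a c b`. -/
def cyc (a b c : ℕ × ℕ) : ℕ := a.1 * b.2 + b.1 * c.2 + c.1 * a.2

/-- The set of the points of a list. -/
def pts (R : List (ℕ × ℕ)) : Finset (ℤ × ℤ) := (R.map toZ).toFinset

/-- The absolute value of the area. -/
def absArea (a b c : ℕ × ℕ) : ℕ := (cyc a b c - cyc a c b) + (cyc a c b - cyc a b c)

/-- The oriented primitive edges of a list of points which have all the points on their left. -/
def edges (R : List (ℕ × ℕ)) : List ((ℕ × ℕ) × (ℕ × ℕ)) :=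
  (R ×ˢ R).filter fun e =>
    Nat.beq (Nat.gcd ((e.2.1 - e.1.1) + (e.1.1 - e.2.1)) ((e.2.2 - e.1.2) + (e.1.2 - e.2.2))) 1 &&
      R.all fun r => Nat.ble (cyc e.1 r e.2) (cyc e.1 e.2 r)

/-- `y` is the image of `x` under the affine map which sends `p`, `p + (1, 0)`, `p + (0, 1)`
to `a`, `b`, `c`. -/
def isImage (p a b c x y : ℕ × ℕ) : Bool :=
  -- This is `y = a + (x.1 - p.1)(b - a) + (x.2 - p.2)(c - a)` with negative terms moved across.
  Nat.beq (y.1 + (x.1 + x.2) * a.1 + p.1 * b.1 + p.2 * c.1)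
    (a.1 + x.1 * b.1 + x.2 * c.1 + (p.1 + p.2) * a.1) &&
  Nat.beq (y.2 + (x.1 + x.2) * a.2 + p.1 * b.2 + p.2 * c.2)
    (a.2 + x.1 * b.2 + x.2 * c.2 + (p.1 + p.2) * a.2)

/-- The affine map which sends `p`, `p + (1, 0)`, `p + (0, 1)` to `a`, `b`, `c`, where `p` is the
first point of `R`, is unimodular and sends `R` into `S`. -/
def embeds (R S : List (ℕ × ℕ)) (a b c : ℕ × ℕ) : Bool :=
  match R with
  | [] => false
  | p :: _ => Nat.beq (absArea a b c) 1 && R.all fun x => S.any fun y => isImage p a b c x y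

/-- A numerical invariant of finite sets of lattice points. -/
def invariant (R : List (ℕ × ℕ)) : ℕ :=
  (R.map fun p => (R.map fun a => (R.map fun b => absArea p a b ^ 4).sum).sum ^ 2).sum

/-- Two of the inequalities `-1 ≤ area e.1 e.2 x` for `e ∈ E` bound `u * x.1 + w * x.2` by `m`. -/
def edgeBound (E : List ((ℕ × ℕ) × (ℕ × ℕ))) (u w m : ℤ) : Bool :=
  E.any fun e => E.any fun e' =>
    let n₁ := (e.1.2 : ℤ) - e.2.2
    let n₂ := (e.2.1 : ℤ) - e.1.1
    let n₁' := (e'.1.2 : ℤ) - e'.2.2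
    let n₂' := (e'.2.1 : ℤ) - e'.1.1
    -- By Cramer's rule, `s` and `t` are up to sign the coefficients combining the inner normals
    -- into a multiple of `(u, w)`; the tests below check the signs. The formula for `D` presumes a
    -- unit vector `(u, w)`.
    let s := (u * n₂' - w * n₁').natAbs
    let t := (u * n₂ - w * n₁).natAbs
    let D := -(u * (s * n₁ + t * n₁') + w * (s * n₂ + t * n₂'))
    decide (0 < D) && decide (s * n₁ + t * n₁' = -(D * u)) &&
      decide (s * n₂ + t * n₂' = -(D * w)) &&
      decide (s * (1 - n₁ * e.1.1 - n₂ * e.1.2) + t * (1 - n₁' * e'.1.1 - n₂' * e'.1.2) <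
        D * (m + 1))

/-- The points with coordinates at most `m`. -/
def grid (m : ℕ) : List (ℕ × ℕ) := List.range (m + 1) ×ˢ List.range (m + 1)

/-- The points outside `R` whose addition to `R` creates no further lattice points. -/
def candidates (R : List (ℕ × ℕ)) : List (ℕ × ℕ) :=
  (grid 12).filter fun v =>
    ((edges R).all fun e => Nat.ble (cyc e.1 v e.2) (cyc e.1 e.2 v + 1)) && !R.contains v

/-- Pairs of entries at equal places satisfy `p`, and no entry of the first list is left over. -/
def allZip {α β : Type} (p : α → β → Bool) : List α → List β → Bool
  | [], _ => true
  | _ :: _, [] => false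
  | a :: l, b :: m => p a b && allZip p l m

/-- The decimal digits of `code` give a member `R'` of `Rs` and three points of `v :: R` which
determine a map of `R'` into `v :: R`. -/
def extensionCheck (Rs : List (List (ℕ × ℕ))) (R : List (ℕ × ℕ)) (v : ℕ × ℕ) (code : ℕ) : Bool :=
  match Rs[code / 1000]? with
  | none => false
  -- The listed planar sets begin with `p`, `p + (1, 0)`, `p + (0, 1)`, so three images fix the map.
  -- The default `v` is harmless, as `embeds` tests whatever points it receives.
  | some R' => embeds R' (v :: R) ((v :: R).getD (code / 100 % 10) v)
      ((v :: R).getD (code / 10 % 10) v) ((v :: R).getD (code % 10) v)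

/-- All extensions of the members of `Rs` by one point are equivalent to members of `Rs'`. -/
def levelCheck (Rs : List (List (ℕ × ℕ) × List ℕ)) (Rs' : List (List (ℕ × ℕ))) : Bool :=
  -- The four bounds confine every possible new point to `[0, 12]²`, the grid searched by
  -- `candidates`.
  Rs.all fun R => edgeBound (edges R.1) 1 0 12 && edgeBound (edges R.1) 0 1 12 &&
    edgeBound (edges R.1) (-1) 0 0 && edgeBound (edges R.1) 0 (-1) 0 &&
    allZip (extensionCheck Rs' R.1) (candidates R.1) R.2

/-- The list `R` contains all points of the grid which lie to the left of its edges. -/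
def hullCheck (R : List (ℕ × ℕ)) : Bool :=
  (grid 7).all fun v =>
    ((edges R).any fun e => Nat.blt (cyc e.1 e.2 v) (cyc e.1 v e.2)) || R.contains v

/-! ### Representatives with three to eight points, and their extension codes. -/

/-- The two-dimensional lattice polygons with three lattice points, with
codes for their extensions by one point. -/
def polygonsThree : List (List (ℕ × ℕ) × List ℕ) := [
  ([(1, 1), (2, 1), (1, 2)], [102, 1031, 2013, 1013, 301, 1021, 1023, 2012, 2023, 1012, 1032,
    201])]

/-- The two-dimensional lattice polygons with four lattice points, with
codes for their extensions by one point. -/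
def polygonsFour : List (List (ℕ × ℕ) × List ℕ) := [
  ([(2, 2), (3, 2), (2, 3), (1, 1)], [124, 1034, 1024, 123, 1023, 132]),
  ([(1, 1), (2, 1), (1, 2), (1, 3)], [103, 2130, 1102, 3031, 1402, 2430, 403, 4021, 4024, 5103,
    5123, 2321]),
  ([(1, 1), (2, 1), (1, 2), (2, 2)], [1423, 5031, 5013, 1214, 5021, 5043, 5012, 5034, 1314, 5042,
    5024, 1123])]

/-- The two-dimensional lattice polygons with five lattice points, with
codes for their extensions by one point. -/
def polygonsFive : List (List (ℕ × ℕ) × List ℕ) := [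
  ([(2, 2), (3, 2), (2, 3), (1, 1), (2, 4)], [123, 1012, 2123, 143]),
  ([(1, 1), (2, 1), (1, 2), (2, 2), (3, 3)], [3012, 4031, 453, 4021, 452, 5301, 5201, 1142]),
  ([(1, 2), (2, 2), (1, 3), (1, 1), (3, 2)], [6142, 132, 7013, 142, 6132, 4401, 4301, 8123]),
  ([(1, 2), (2, 2), (1, 3), (3, 1), (3, 2)], [7523, 5013, 7421, 5014, 5035, 7321, 5045, 7123]),
  ([(1, 1), (2, 1), (1, 2), (1, 3), (1, 4)], [2103, 8130, 1130, 7130, 3130, 7540, 1540, 8540,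
    2504, 9021, 9025, 10103, 10123]),
  ([(1, 1), (2, 1), (1, 2), (1, 3), (2, 2)], [103, 4251, 5215, 5524, 4524, 403, 10021, 10054,
    11012, 11045, 4453, 12025, 4123])]

/-- The two-dimensional lattice polygons with six lattice points, with
codes for their extensions by one point. -/
def polygonsSix : List (List (ℕ × ℕ) × List ℕ) := [
  ([(2, 2), (3, 2), (2, 3), (1, 1), (1, 2), (2, 4)], [134, 1054, 2065, 3405, 4123, 5210]),
  ([(1, 2), (2, 2), (1, 3), (2, 1), (3, 2), (4, 2)], [6013, 7031, 7041, 3310, 3410, 8123]),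
  ([(2, 2), (3, 2), (2, 3), (1, 1), (2, 4), (2, 5)], [4123, 8012, 9123, 4143]),
  ([(1, 2), (2, 2), (1, 3), (3, 2), (4, 1), (4, 2)], [6643, 10013, 10063, 10015, 10065, 6123]),
  ([(1, 1), (2, 1), (1, 2), (1, 3), (2, 2), (3, 2)], [1652, 2261, 10102, 5034, 1132, 11021, 2103,
    12123, 13132, 7123]),
  ([(1, 1), (2, 1), (1, 2), (2, 2), (2, 3), (3, 2)], [5543, 13031, 10261, 13021, 12053, 10351,
    3123, 12062, 14056, 3132]),
  ([(2, 2), (3, 2), (2, 3), (1, 2), (2, 4), (4, 1)], [1410, 1620, 1530]),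
  ([(1, 2), (2, 2), (1, 3), (3, 1), (3, 2), (4, 2)], [15013, 3013, 3014, 10310, 10410, 16123]),
  ([(1, 2), (2, 2), (1, 3), (1, 1), (3, 2), (4, 2)], [4132, 16013, 4142, 7401, 7301, 17123]),
  ([(1, 1), (2, 1), (1, 2), (1, 3), (1, 4), (1, 5)], [9103, 17130, 8130, 16130, 6130, 15130, 6650,
    16650, 8650, 17650, 9605, 18021, 18026, 19103, 19123]),
  ([(1, 1), (2, 1), (1, 2), (1, 3), (1, 4), (2, 2)], [4103, 7261, 3216, 10216, 10652, 3652, 7625,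
    4504, 19021, 19065, 20103, 20123, 11564, 11123]),
  ([(1, 1), (2, 1), (1, 2), (1, 3), (2, 2), (2, 3)], [2645, 13215, 12215, 13645, 2215, 20021,
    20064, 20012, 20046, 2463, 13123, 12123, 13463, 2123]),
  ([(1, 1), (2, 1), (1, 2), (1, 3), (2, 2), (3, 1)], [123, 11652, 13652, 13625, 11625, 435, 11453,
    11123, 13453, 13123, 13435, 13132, 11435, 11132, 625])]

/-- The two-dimensional lattice polygons with seven lattice points, with
codes for their extensions by one point. -/
def polygonsSeven : List (List (ℕ × ℕ) × List ℕ) := [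
  ([(2, 2), (3, 2), (2, 3), (1, 1), (2, 4), (3, 3), (4, 2)], [123, 132, 1123, 2065, 2067, 1132]),
  ([(1, 2), (2, 2), (1, 3), (2, 3), (2, 4), (3, 2), (4, 1)], [3642, 2120, 4053, 5123, 5540]),
  ([(1, 1), (2, 1), (1, 2), (1, 3), (2, 2), (2, 3), (3, 4)], [6153, 7031, 5034, 2132, 8021, 9361,
    10403, 11123]),
  ([(1, 1), (2, 1), (1, 2), (2, 2), (2, 3), (2, 4), (3, 2)], [451, 4271, 12021, 10123, 13103,
    14123, 15072, 16123]),
  ([(2, 2), (3, 2), (2, 3), (1, 1), (1, 2), (2, 4), (2, 5)], [1143, 9510, 14405, 17123, 18210]),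
  ([(1, 2), (2, 2), (1, 3), (2, 3), (2, 4), (3, 1), (3, 2)], [214, 5627, 11053, 16103, 18123,
    11057, 264, 5123]),
  ([(1, 2), (2, 2), (1, 3), (3, 2), (4, 1), (4, 2), (5, 2)], [19013, 20013, 13310, 20015, 13510,
    21123]),
  ([(1, 1), (2, 1), (1, 2), (1, 3), (2, 2), (3, 2), (4, 2)], [3315, 9132, 20102, 18034, 22351,
    15123, 12132, 23123]),
  ([(1, 2), (2, 2), (1, 3), (2, 1), (3, 2), (4, 2), (5, 2)], [21013, 23031, 23041, 14310, 14410,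
    24123]),
  ([(2, 2), (3, 2), (2, 3), (1, 1), (2, 4), (2, 5), (2, 6)], [17123, 24012, 25123, 17143]),
  ([(1, 1), (2, 1), (1, 2), (2, 2), (2, 3), (2, 4), (3, 3)], [26013, 7241, 10021, 27063, 13361,
    20123, 16027, 28067]),
  ([(1, 1), (2, 1), (1, 2), (1, 3), (1, 4), (2, 2), (3, 1)], [1123, 22132, 4102, 7132, 26132, 436,
    3564, 29123, 8103, 30123, 31324, 22463]),
  ([(1, 1), (2, 1), (1, 2), (1, 3), (2, 2), (2, 3), (3, 2)], [5752, 11271, 28102, 11674, 5756,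
    30021, 30064, 10463, 10123, 32123, 32436, 15123]),
  ([(1, 1), (2, 1), (1, 2), (1, 3), (2, 2), (2, 3), (3, 1)], [2654, 31132, 11102, 33237, 7752,
    8463, 30123, 27103, 12123, 11463, 32123, 4463]),
  ([(1, 1), (2, 1), (1, 2), (2, 2), (2, 3), (3, 2), (3, 3)], [16573, 32013, 16261, 32012, 32035,
    16351, 16123, 32026, 32057, 16132, 32067, 16216]),
  ([(1, 2), (2, 2), (1, 3), (3, 2), (4, 2), (5, 1), (5, 2)], [34753, 13013, 13073, 13016, 13076,
    34123]),
  ([(1, 2), (2, 2), (1, 3), (3, 1), (3, 2), (4, 2), (5, 2)], [34013, 14013, 14014, 20310, 20410,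
    35123]),
  ([(1, 2), (2, 2), (1, 3), (1, 1), (3, 2), (4, 2), (5, 2)], [17132, 35013, 17142, 23401, 23301,
    36123]),
  ([(1, 1), (2, 1), (1, 2), (1, 3), (1, 4), (1, 5), (1, 6)], [25103, 36130, 24130, 35130, 21130,
    34130, 19130, 34760, 21760, 35760, 24760, 36760, 25706, 37021, 37027, 38103, 38123]),
  ([(1, 1), (2, 1), (1, 2), (1, 3), (1, 4), (1, 5), (2, 2)], [17103, 23271, 14217, 20217, 13217,
    13762, 20762, 14762, 23726, 17605, 38021, 38076, 39103, 39123, 29324]),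
  ([(1, 1), (2, 1), (1, 2), (1, 3), (1, 4), (2, 2), (2, 3)], [9617, 12216, 10216, 27216, 10756,
    12756, 9652, 39021, 39075, 40012, 40057, 8574, 30123, 30574, 8123])]

/-- The two-dimensional lattice polygons with eight lattice points. -/
def polygonsEight : List (List (ℕ × ℕ)) := [
  [(2, 2), (3, 2), (2, 3), (1, 1), (1, 2), (2, 4), (3, 3), (4, 2)],
  [(2, 2), (3, 2), (2, 3), (1, 1), (2, 4), (2, 5), (3, 3), (4, 2)],
  [(1, 2), (2, 2), (1, 3), (2, 3), (3, 1), (3, 2), (3, 3), (4, 4)],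
  [(2, 2), (3, 2), (2, 3), (1, 2), (2, 4), (2, 5), (3, 3), (4, 1)],
  [(1, 1), (2, 1), (1, 2), (1, 3), (2, 2), (2, 3), (3, 3), (4, 4)],
  [(1, 2), (2, 2), (1, 3), (2, 3), (2, 4), (3, 1), (3, 2), (4, 1)],
  [(2, 2), (3, 2), (2, 3), (1, 2), (2, 4), (3, 1), (3, 3), (4, 3)],
  [(1, 2), (2, 2), (1, 3), (1, 4), (2, 3), (3, 1), (3, 2), (4, 2)],
  [(1, 1), (2, 1), (1, 2), (1, 3), (1, 4), (2, 2), (2, 3), (3, 3)],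
  [(1, 2), (2, 2), (1, 3), (1, 1), (2, 3), (2, 4), (2, 5), (3, 2)],
  [(1, 1), (2, 1), (1, 2), (1, 3), (2, 2), (2, 3), (2, 4), (3, 2)],
  [(1, 1), (2, 1), (1, 2), (1, 3), (2, 2), (2, 3), (3, 3), (3, 4)],
  [(1, 1), (2, 1), (1, 2), (1, 3), (2, 2), (2, 3), (2, 4), (3, 1)],
  [(1, 1), (2, 1), (1, 2), (2, 2), (2, 3), (2, 4), (2, 5), (3, 4)],
  [(1, 1), (2, 1), (1, 2), (2, 2), (2, 3), (2, 4), (2, 5), (3, 2)],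
  [(1, 1), (2, 1), (1, 2), (1, 3), (2, 2), (2, 3), (3, 2), (4, 2)],
  [(1, 1), (2, 1), (1, 2), (2, 2), (2, 3), (2, 4), (3, 2), (3, 3)],
  [(2, 2), (3, 2), (2, 3), (1, 1), (1, 2), (2, 4), (2, 5), (2, 6)],
  [(1, 2), (2, 2), (1, 3), (2, 3), (2, 4), (2, 5), (3, 1), (3, 2)],
  [(1, 2), (2, 2), (1, 3), (3, 2), (4, 2), (5, 2), (6, 1), (6, 2)],
  [(1, 1), (2, 1), (1, 2), (2, 2), (2, 3), (2, 4), (2, 5), (3, 3)],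
  [(1, 2), (2, 2), (1, 3), (3, 2), (4, 1), (4, 2), (5, 2), (6, 2)],
  [(1, 2), (2, 2), (1, 3), (1, 1), (1, 4), (2, 3), (3, 2), (4, 2)],
  [(1, 1), (2, 1), (1, 2), (1, 3), (2, 2), (3, 2), (4, 2), (5, 2)],
  [(1, 2), (2, 2), (1, 3), (2, 1), (3, 2), (4, 2), (5, 2), (6, 2)],
  [(2, 2), (3, 2), (2, 3), (1, 1), (2, 4), (2, 5), (2, 6), (2, 7)],
  [(1, 2), (2, 2), (1, 3), (1, 4), (2, 3), (3, 2), (4, 1), (4, 2)],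
  [(1, 1), (2, 1), (1, 2), (1, 3), (2, 2), (2, 3), (2, 4), (3, 3)],
  [(1, 1), (2, 1), (1, 2), (2, 2), (2, 3), (2, 4), (3, 3), (3, 4)],
  [(1, 2), (2, 2), (1, 3), (1, 1), (1, 4), (1, 5), (2, 3), (3, 2)],
  [(1, 1), (2, 1), (1, 2), (1, 3), (1, 4), (2, 2), (2, 3), (3, 1)],
  [(1, 2), (2, 2), (1, 3), (1, 1), (1, 4), (2, 3), (3, 2), (3, 3)],
  [(1, 1), (2, 1), (1, 2), (1, 3), (2, 2), (2, 3), (3, 1), (3, 2)],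
  [(1, 2), (2, 2), (1, 3), (1, 1), (2, 3), (3, 2), (3, 3), (3, 4)],
  [(1, 2), (2, 2), (1, 3), (3, 2), (4, 2), (5, 1), (5, 2), (6, 2)],
  [(1, 2), (2, 2), (1, 3), (3, 1), (3, 2), (4, 2), (5, 2), (6, 2)],
  [(1, 2), (2, 2), (1, 3), (1, 1), (3, 2), (4, 2), (5, 2), (6, 2)],
  [(1, 1), (2, 1), (1, 2), (1, 3), (1, 4), (1, 5), (1, 6), (1, 7)],
  [(1, 1), (2, 1), (1, 2), (1, 3), (1, 4), (1, 5), (1, 6), (2, 2)],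
  [(1, 1), (2, 1), (1, 2), (1, 3), (1, 4), (1, 5), (2, 2), (2, 3)],
  [(1, 1), (2, 1), (1, 2), (1, 3), (1, 4), (2, 2), (2, 3), (2, 4)]]
/-- The lattice polygons with eight lattice points. -/
def polygonsEightAll : List (List (ℕ × ℕ)) :=
  ((List.range 8).map fun i => (i, 0)) :: polygonsEight

/-! ### Evaluation of the certificates. -/

theorem levelCheck_three : levelCheck polygonsThree (polygonsFour.map Prod.fst) = true := by
  decide +kernel

theorem levelCheck_four : levelCheck polygonsFour (polygonsFive.map Prod.fst) = true := by
  decide +kernel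

theorem levelCheck_five : levelCheck polygonsFive (polygonsSix.map Prod.fst) = true := by
  decide +kernel

theorem levelCheck_six : levelCheck polygonsSix (polygonsSeven.map Prod.fst) = true := by
  decide +kernel

theorem levelCheck_seven : levelCheck polygonsSeven polygonsEight = true := by
  decide +kernel

theorem hullCheck_polygonsEightAll : polygonsEightAll.all hullCheck = true := by
  decide +kernel

/-- Squaring the sum at each `p` lets the invariant see how the areas are distributed among the
points, and not only their total. -/
theorem nodup_map_invariant : (polygonsEightAll.map invariant).Nodup := by
  decide +kernel

/-! ### Soundness of the certificates. -/

theorem toZ_injective : Function.Injective toZ := fun p q h => by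
  simp only [toZ, Prod.mk.injEq, Nat.cast_inj] at h
  exact Prod.ext h.1 h.2

theorem mem_pts {R : List (ℕ × ℕ)} {x : ℤ × ℤ} : x ∈ pts R ↔ ∃ r ∈ R, toZ r = x := by
  simp [pts]

theorem pts_cons (v : ℕ × ℕ) (R : List (ℕ × ℕ)) : pts (v :: R) = insert (toZ v) (pts R) := by
  simp [pts]

theorem card_pts {R : List (ℕ × ℕ)} (h : R.Nodup) : (pts R).card = R.length := by
  rw [pts, List.toFinset_card_of_nodup (h.map toZ_injective), List.length_map]

theorem area_toZ (a b c : ℕ × ℕ) : area (toZ a) (toZ b) (toZ c) = cyc a b c - cyc a c b := by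
  simp only [area, toZ, cyc]
  push_cast
  ring

theorem absArea_eq (a b c : ℕ × ℕ) : absArea a b c = (area (toZ a) (toZ b) (toZ c)).natAbs := by
  rw [area_toZ, absArea]
  omega

theorem mem_edges {R : List (ℕ × ℕ)} {e : (ℕ × ℕ) × (ℕ × ℕ)} (h : e ∈ edges R) :
    toZ e.1 ∈ pts R ∧ toZ e.2 ∈ pts R ∧
      Int.gcd ((toZ e.2).1 - (toZ e.1).1) ((toZ e.2).2 - (toZ e.1).2) = 1 ∧
      ∀ r ∈ pts R, 0 ≤ area (toZ e.1) (toZ e.2) r := by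
  obtain ⟨a, b⟩ := e
  simp only [edges, List.mem_filter, List.mem_product, Bool.and_eq_true, Nat.beq_eq,
    List.all_eq_true, Nat.ble_eq] at h
  obtain ⟨⟨h1, h2⟩, h3, h4⟩ := h
  refine ⟨mem_pts.2 ⟨_, h1, rfl⟩, mem_pts.2 ⟨_, h2, rfl⟩, ?_, fun r hr => ?_⟩
  · rw [Int.gcd_def, ← h3]
    simp only [toZ]
    congr 1 <;> omega
  · obtain ⟨r, hr', rfl⟩ := mem_pts.1 hr
    have := h4 r hr'
    simp only [area_toZ]
    omega

theorem uniAff_affMap {p a b c : ℤ × ℤ} (h : (area a b c).natAbs = 1) :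
    UniAff fun x => (a.1 + (x.1 - p.1) * (b.1 - a.1) + (x.2 - p.2) * (c.1 - a.1),
      a.2 + (x.1 - p.1) * (b.2 - a.2) + (x.2 - p.2) * (c.2 - a.2)) := by
  refine ⟨b.1 - a.1, c.1 - a.1, b.2 - a.2, c.2 - a.2, a.1 - p.1 * (b.1 - a.1) - p.2 * (c.1 - a.1),
    a.2 - p.1 * (b.2 - a.2) - p.2 * (c.2 - a.2), ?_, fun x => ?_⟩
  · rw [area] at h
    rcases Int.natAbs_eq_iff.1 h with h | h
    · left; linear_combination h
    · right; linear_combination h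
  · ext <;> simp only <;> ring

theorem exists_uniAff_of_embeds {R S : List (ℕ × ℕ)} {a b c : ℕ × ℕ}
    (h : embeds R S a b c = true) : ∃ f, UniAff f ∧ (pts R).image f ⊆ pts S := by
  rcases R with - | ⟨p, R⟩
  · simp [embeds] at h
  simp only [embeds, Bool.and_eq_true, Nat.beq_eq, List.all_eq_true, List.any_eq_true,
    absArea_eq, isImage] at h
  refine ⟨_, uniAff_affMap (p := toZ p) h.1, fun y hy => ?_⟩
  obtain ⟨x, hx, rfl⟩ := Finset.mem_image.1 hy
  obtain ⟨x, hx', rfl⟩ := mem_pts.1 hx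
  obtain ⟨y, hy, h1, h2⟩ := h.2 x hx'
  refine mem_pts.2 ⟨y, hy, ?_⟩
  zify at h1 h2
  ext
  · simp only [toZ]
    linear_combination h1
  · simp only [toZ]
    linear_combination h2

/-- The two half-plane inequalities are added with weights `s` and `t`. The strict comparison with
`D * (m + 1)` performs the rounding down to integers. -/
theorem le_of_edgeBound {E : List ((ℕ × ℕ) × (ℕ × ℕ))} {u w m : ℤ} (h : edgeBound E u w m = true)
    {x : ℤ × ℤ} (hx : ∀ e ∈ E, -1 ≤ area (toZ e.1) (toZ e.2) x) : u * x.1 + w * x.2 ≤ m := by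
  simp only [edgeBound, List.any_eq_true, Bool.and_eq_true, decide_eq_true_eq] at h
  obtain ⟨e, he, e', he', ⟨⟨hD, h1⟩, h2⟩, hK⟩ := h
  have a1 := hx e he
  have a2 := hx e' he'
  simp only [area, toZ] at a1 a2
  generalize Int.natAbs _ = s at *
  generalize Int.natAbs _ = t at *
  generalize -(u * _ + w * _) = D at *
  have b1 := mul_nonneg (Int.natCast_nonneg s) (sub_nonneg.2 a1)
  have b2 := mul_nonneg (Int.natCast_nonneg t) (sub_nonneg.2 a2)
  have : D * (u * x.1 + w * x.2) < D * (m + 1) := by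
    linear_combination hK + b1 + b2 + x.1 * h1 + x.2 * h2
  exact Int.lt_add_one_iff.1 (lt_of_mul_lt_mul_left this hD.le)

theorem exists_of_allZip {α β : Type} {p : α → β → Bool} {l : List α} {m : List β}
    (h : allZip p l m = true) {a : α} (ha : a ∈ l) : ∃ b, p a b = true := by
  induction l generalizing m with
  | nil => simp at ha
  | cons x l ih =>
    rcases m with - | ⟨y, m⟩
    · simp [allZip] at h
    simp only [allZip, Bool.and_eq_true] at h
    rcases List.mem_cons.1 ha with rfl | ha
    · exact ⟨y, h.1⟩
    · exact ih h.2 ha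

theorem mem_grid {m : ℕ} {v : ℕ × ℕ} : v ∈ grid m ↔ v.1 ≤ m ∧ v.2 ≤ m := by
  obtain ⟨a, b⟩ := v
  simp [grid]

/-! ### Classification by adding one point at a time. -/

/-- Every two-dimensional set closed under triangles with `n` points is equivalent to a member
of `Rs`. -/
def Classifies (n : ℕ) (Rs : List (List (ℕ × ℕ))) : Prop :=
  ∀ S : Finset (ℤ × ℤ), TriClosed S → ¬ CollinearPts S → S.card = n →
    ∃ R ∈ Rs, UniEquiv S (pts R)

theorem Classifies.succ {n : ℕ} (hn : 3 ≤ n) {Rs : List (List (ℕ × ℕ) × List ℕ)}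
    {Rs' : List (List (ℕ × ℕ))} (h : Classifies n (Rs.map Prod.fst))
    (hc : levelCheck Rs Rs' = true) (hl : ∀ R ∈ Rs', R.length = n + 1 ∧ R.Nodup) :
    Classifies (n + 1) Rs' := by
  intro S hS hcol hcard
  obtain ⟨v, hv, hvS, hvcol⟩ := hS.exists_erase hcol (by omega)
  obtain ⟨_, hR, f, hf, hfR⟩ := h _ hvS hvcol (by rw [Finset.card_erase_of_mem hv]; omega)
  obtain ⟨⟨R, codes⟩, hRs, rfl⟩ := List.mem_map.1 hR
  simp only at hfR
  have hS' : S.image f = insert (f v) (pts R) := by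
    rw [← hfR, ← Finset.image_insert, Finset.insert_erase hv]
  have hT := hS.image hf
  have hnot : f v ∉ pts R := fun hm => by
    rw [← hfR, Finset.mem_image] at hm
    obtain ⟨x, hx, hxv⟩ := hm
    exact (Finset.mem_erase.1 hx).1 (hf.injective hxv)
  have hedge : ∀ e ∈ edges R, -1 ≤ area (toZ e.1) (toZ e.2) (f v) := fun e he => by
    obtain ⟨h1, h2, h3, h4⟩ := mem_edges he
    by_contra! hlt
    rw [hS'] at hT
    obtain ⟨w, hw, hw'⟩ := hT.exists_area_eq_neg_one (Finset.mem_insert_of_mem h1)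
      (Finset.mem_insert_of_mem h2) (Finset.mem_insert_self _ _) h3 (by omega)
    -- A point at height `-1` is neither `f v`, whose height is at most `-2`, nor in `R`, whose
    -- heights are nonnegative.
    rcases Finset.mem_insert.1 hw with rfl | hw
    · omega
    · have := h4 w hw
      omega
  simp only [levelCheck, List.all_eq_true, Bool.and_eq_true] at hc
  obtain ⟨⟨⟨⟨b1, b2⟩, b3⟩, b4⟩, hzip⟩ := hc _ hRs
  have c1 := le_of_edgeBound b1 hedge
  have c2 := le_of_edgeBound b2 hedge
  have c3 := le_of_edgeBound b3 hedge
  have c4 := le_of_edgeBound b4 hedge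
  obtain ⟨v', hv'⟩ : ∃ v' : ℕ × ℕ, toZ v' = f v :=
    ⟨((f v).1.toNat, (f v).2.toNat), by ext <;> simp only [toZ] <;> omega⟩
  rw [← hv'] at hS' hnot hedge c1 c2 c3 c4
  have hmem : v' ∈ candidates R := by
    simp only [candidates, List.mem_filter, mem_grid, Bool.and_eq_true, List.all_eq_true,
      Nat.ble_eq, Bool.not_eq_true', List.contains_eq_mem, decide_eq_false_iff_not]
    refine ⟨?_, fun e he => ?_, fun hm => hnot (mem_pts.2 ⟨_, hm, rfl⟩)⟩
    · simp only [toZ] at c1 c2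
      omega
    · have := hedge e he
      rw [area_toZ] at this
      omega
  obtain ⟨code, hcode⟩ := exists_of_allZip hzip hmem
  rw [extensionCheck] at hcode
  split at hcode
  · simp at hcode
  rename_i R' hR'
  have hR' := List.mem_of_getElem? hR'
  obtain ⟨g, hg, hgR⟩ := exists_uniAff_of_embeds hcode
  rw [pts_cons, ← hS'] at hgR
  refine ⟨R', hR', UniEquiv.trans ⟨f, hf, rfl⟩ (UniEquiv.symm ⟨g, hg, ?_⟩)⟩
  -- An inclusion suffices: both sets have `n + 1` points.
  refine Finset.eq_of_subset_of_card_le hgR ?_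
  rw [Finset.card_image_of_injective _ hg.injective, Finset.card_image_of_injective _ hf.injective,
    card_pts (hl R' hR').2, (hl R' hR').1, hcard]

/-- A larger area would produce a lattice point at height one over the primitive edge, distinct from
all three vertices. -/
theorem TriClosed.area_le_one {S : Finset (ℤ × ℤ)} (hS : TriClosed S) {a b c : ℤ × ℤ}
    (hSe : S = {a, b, c}) (hab : Int.gcd (b.1 - a.1) (b.2 - a.2) = 1) :
    (area a b c).natAbs ≤ 1 := by
  have ha : a ∈ S := by simp [hSe]
  have hb : b ∈ S := by simp [hSe]
  have hc : c ∈ S := by simp [hSe]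
  by_contra! h
  rcases lt_or_ge (area a b c) 0 with h0 | h0
  · obtain ⟨w, hw, hw'⟩ := hS.exists_area_eq_neg_one ha hb hc hab (by omega)
    rw [hSe] at hw
    simp only [Finset.mem_insert, Finset.mem_singleton] at hw
    rcases hw with rfl | rfl | rfl
    · simp [area] at hw'
    · simp only [area] at hw'
      ring_nf at hw'
      omega
    · omega
  -- Reversing the edge reduces positive area to the negative case.
  · have hs : ∀ x, area b a x = -area a b x := fun x => by simp only [area]; ring
    obtain ⟨w, hw, hw'⟩ := hS.exists_area_eq_neg_one hb ha hc
      (by rw [← hab, Int.gcd_def, Int.gcd_def]; congr 1 <;> omega) (by rw [hs]; omega)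
    rw [hSe] at hw
    simp only [Finset.mem_insert, Finset.mem_singleton] at hw
    rcases hw with rfl | rfl | rfl
    · simp only [area] at hw'
      ring_nf at hw'
      omega
    · simp [area] at hw'
    · rw [hs] at hw'
      omega

theorem classifies_three : Classifies 3 (polygonsThree.map Prod.fst) := by
  intro S hS hcol hcard
  refine ⟨[(1, 1), (2, 1), (1, 2)], by simp [polygonsThree], ?_⟩
  have hab : ∃ a b c, S = {a, b, c} ∧ Int.gcd (b.1 - a.1) (b.2 - a.2) = 1 := by
    obtain ⟨p, q, r, hpq, hpr, hqr, rfl⟩ := Finset.card_eq_three.1 hcard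
    obtain ⟨q', hq', g, hg, hgcd, -⟩ := hS.exists_primitive (p := p) (q := q) (by simp) (by simp) hpq
    simp only [Finset.mem_insert, Finset.mem_singleton] at hq'
    rcases hq' with rfl | rfl | rfl
    · simp at hgcd
    · exact ⟨p, q', r, rfl, hgcd⟩
    · exact ⟨p, q', q, by rw [Finset.pair_comm], hgcd⟩
  obtain ⟨a, b, c, hSe, hgcd⟩ := hab
  have hle := hS.area_le_one hSe hgcd
  have hne : area a b c ≠ 0 := fun h0 => by
    have hab : a ≠ b := by
      rintro rfl
      simp at hgcd
    have hall : ∀ x ∈ S, area a b x = 0 := fun x hx => by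
      rw [hSe] at hx
      simp only [Finset.mem_insert, Finset.mem_singleton] at hx
      rcases hx with rfl | rfl | rfl
      · simp [area]
      · simp only [area]; ring
      · exact h0
    exact hcol fun p hp q hq r hr => area_eq_zero_of_collinear hab (hall p hp) (hall q hq) (hall r hr)
  refine UniEquiv.symm ⟨_, uniAff_affMap (p := (1, 1)) (a := a) (b := b) (c := c) (by omega), ?_⟩
  simp [pts, toZ, hSe]

theorem classifies_eight : Classifies 8 polygonsEight := by
  have h4 := classifies_three.succ le_rfl levelCheck_three (by decide +kernel)
  have h5 := h4.succ (by norm_num) levelCheck_four (by decide +kernel)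
  have h6 := h5.succ (by norm_num) levelCheck_five (by decide +kernel)
  have h7 := h6.succ (by norm_num) levelCheck_six (by decide +kernel)
  exact h7.succ (by norm_num) levelCheck_seven (by decide +kernel)

theorem TriClosed.exists_uniEquiv_of_card_eq_eight {S : Finset (ℤ × ℤ)} (hS : TriClosed S)
    (h : S.card = 8) : ∃ R ∈ polygonsEightAll, UniEquiv S (pts R) := by
  by_cases hc : CollinearPts S
  · refine ⟨_, List.mem_cons_self, ?_⟩
    convert hS.uniEquiv_segment hc h using 1
    decide
  · obtain ⟨R, hR, h⟩ := classifies_eight S hS hc h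
    exact ⟨R, List.mem_cons_of_mem _ hR, h⟩

theorem length_nodup_polygonsEightAll :
    ∀ R ∈ polygonsEightAll, R.length = 8 ∧ R.Nodup ∧ ∀ r ∈ R, r.1 ≤ 7 ∧ r.2 ≤ 7 := by
  decide +kernel

/-! ### The area invariant. -/

theorem invariant_eq_sum {R : List (ℕ × ℕ)} (h : R.Nodup) :
    invariant R = ∑ p ∈ pts R, (∑ a ∈ pts R, ∑ b ∈ pts R, (area p a b).natAbs ^ 4) ^ 2 := by
  have key : ∀ F : ℤ × ℤ → ℕ, ∑ x ∈ pts R, F x = (R.map fun r => F (toZ r)).sum := fun F => by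
    rw [pts, List.sum_toFinset _ (h.map toZ_injective), List.map_map]
    rfl
  simp only [key, invariant, absArea_eq]

/-- Unimodular maps preserve absolute areas, and the sums run over the point set independently of
its listing. -/
theorem UniEquiv.invariant_eq {R R' : List (ℕ × ℕ)} (hR : R.Nodup) (hR' : R'.Nodup)
    (h : UniEquiv (pts R) (pts R')) : invariant R = invariant R' := by
  obtain ⟨f, hf, h⟩ := h
  obtain ⟨δ, hδ, hfa⟩ := hf.area_eq
  rw [invariant_eq_sum hR, invariant_eq_sum hR', ← h]
  have habs : ∀ p q r, (area (f p) (f q) (f r)).natAbs = (area p q r).natAbs := fun p q r => by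
    rw [hfa]
    rcases hδ with rfl | rfl <;> simp
  simp only [Finset.sum_image hf.injective.injOn, habs]

/-! ### From finite point sets to real polygons. -/

/-- The coordinates of a lattice point, as a pair. -/
def toPair (p : Fin 2 → ℤ) : ℤ × ℤ := (p 0, p 1)

theorem toPair_vec (x : ℤ × ℤ) : toPair ![x.1, x.2] = x := rfl

theorem toPair_injective : Function.Injective toPair := fun p q h => by
  simp only [toPair, Prod.mk.injEq] at h
  ext i
  fin_cases i
  exacts [h.1, h.2]

/-- The convex hull of a finite set of lattice points. -/
def polygonOf (S : Finset (ℤ × ℤ)) : Set (Fin 2 → ℝ) :=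
  convexHull ℝ (latticePt '' {p | toPair p ∈ S})

theorem isLatticePolygon_polygonOf {S : Finset (ℤ × ℤ)} (hS : S.Nonempty) :
    IsLatticePolygon (polygonOf S) := by
  refine ⟨S.image fun x => ![x.1, x.2], hS.image _, ?_⟩
  rw [polygonOf]
  congr 2
  ext p
  simp only [Set.mem_ofPred_eq, Finset.coe_image, Set.mem_image, Finset.mem_coe]
  exact ⟨fun h => ⟨_, h, toPair_injective rfl⟩, fun ⟨x, hx, h⟩ => by rw [← h]; exact hx⟩

theorem latticePt_injective : Function.Injective latticePt := fun p q h => by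
  ext i
  exact Int.cast_injective (α := ℝ) (congrFun h i)

theorem mem_latticePoints_polygonOf {S : Finset (ℤ × ℤ)} {p : Fin 2 → ℤ} (h : toPair p ∈ S) :
    p ∈ latticePoints (polygonOf S) :=
  subset_convexHull ℝ _ ⟨p, h, rfl⟩

theorem halfPlane_of_mem_polygonOf {S : Finset (ℤ × ℤ)} {u w k : ℤ}
    (h : ∀ x ∈ S, 0 ≤ u * x.1 + w * x.2 + k) {y : Fin 2 → ℝ} (hy : y ∈ polygonOf S) :
    0 ≤ u * y 0 + w * y 1 + k := by
  have hsub : polygonOf S ⊆ {y : Fin 2 → ℝ | 0 ≤ u * y 0 + w * y 1 + k} := by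
    refine convexHull_min ?_ ?_
    · rintro _ ⟨p, hp, rfl⟩
      have := h _ hp
      simp only [toPair] at this
      simp only [latticePt, Set.mem_ofPred_eq]
      exact_mod_cast this
    · intro x hx z hz a b ha hb hab
      simp only [Set.mem_ofPred_eq, Pi.add_apply, Pi.smul_apply, smul_eq_mul] at *
      linear_combination mul_nonneg ha hx + mul_nonneg hb hz + (k : ℝ) * hab
  exact hsub hy

theorem IsLatticePolygon.convex {P : Set (Fin 2 → ℝ)} (h : IsLatticePolygon P) : Convex ℝ P := by
  obtain ⟨S, -, rfl⟩ := h
  exact convex_convexHull ℝ _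

/-- A lattice polygon with finitely many lattice points is the hull of a set closed under
triangles. -/
theorem IsLatticePolygon.exists_triClosed {P : Set (Fin 2 → ℝ)} (h : IsLatticePolygon P)
    (hfin : (latticePoints P).Finite) :
    ∃ S, TriClosed S ∧ P = polygonOf S ∧ S.card = (latticePoints P).ncard := by
  classical
  have hmem : ∀ p, toPair p ∈ hfin.toFinset.image toPair ↔ p ∈ latticePoints P := fun p => by
    simp [toPair_injective.eq_iff]
  refine ⟨hfin.toFinset.image toPair, ?_, ?_, ?_⟩
  · intro p hp q hq r hr x α β γ hα hβ hγ hpos h1 h2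
    rw [← toPair_vec p, hmem] at hp
    rw [← toPair_vec q, hmem] at hq
    rw [← toPair_vec r, hmem] at hr
    rw [← toPair_vec x, hmem]
    have hN : (0 : ℝ) < α + β + γ := by exact_mod_cast hpos
    have hα' : (0 : ℝ) ≤ α := by exact_mod_cast hα
    have hβ' : (0 : ℝ) ≤ β := by exact_mod_cast hβ
    have hγ' : (0 : ℝ) ≤ γ := by exact_mod_cast hγ
    have := h.convex.sum_mem (t := Finset.univ)
      (w := ![(α : ℝ) / (α + β + γ), β / (α + β + γ), γ / (α + β + γ)])
      (z := ![latticePt ![p.1, p.2], latticePt ![q.1, q.2], latticePt ![r.1, r.2]])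
      (by
        intro i _
        fin_cases i
        exacts [div_nonneg hα' hN.le, div_nonneg hβ' hN.le, div_nonneg hγ' hN.le])
      (by
        simp [Fin.sum_univ_three]
        field_simp)
      (by
        intro i _
        fin_cases i
        exacts [hp, hq, hr])
    change latticePt _ ∈ P
    convert this using 1
    have h1' : ((α : ℝ) + β + γ) * x.1 = α * p.1 + β * q.1 + γ * r.1 := by exact_mod_cast h1
    have h2' : ((α : ℝ) + β + γ) * x.2 = α * p.2 + β * q.2 + γ * r.2 := by exact_mod_cast h2
    ext i
    fin_cases i
    · simp [Fin.sum_univ_three, latticePt]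
      field_simp
      linear_combination h1'
    · simp [Fin.sum_univ_three, latticePt]
      field_simp
      linear_combination h2'
  · have hset : {p | toPair p ∈ hfin.toFinset.image toPair} = latticePoints P := Set.ext hmem
    rw [polygonOf, hset]
    -- The generating points of `P` are among its lattice points, and convexity gives the other
    -- inclusion.
    refine subset_antisymm ?_ (convexHull_min ?_ h.convex)
    · obtain ⟨S, -, rfl⟩ := h
      refine convexHull_mono (Set.image_mono fun p hp => ?_)
      exact subset_convexHull ℝ _ ⟨p, hp, rfl⟩
    · rintro _ ⟨p, hp, rfl⟩
      exact hp
  · rw [Finset.card_image_of_injective _ toPair_injective, Set.ncard_eq_toFinset_card _ hfin]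

/-! ### Lattice equivalence of polygons and of their point sets. -/

/-- The integral affine map `p ↦ M p + v`. -/
def intAff (M : GL (Fin 2) ℤ) (v p : Fin 2 → ℤ) : Fin 2 → ℤ :=
  (M : Matrix (Fin 2) (Fin 2) ℤ).mulVec p + v

theorem latticePt_intAff (M : GL (Fin 2) ℤ) (v p : Fin 2 → ℤ) :
    latticePt (intAff M v p) =
      ((M : Matrix (Fin 2) (Fin 2) ℤ).map (Int.cast : ℤ → ℝ)).mulVec (latticePt p) +
        latticePt v := by
  ext i
  fin_cases i <;> simp [latticePt, intAff]

theorem mulVec_map_injective (M : GL (Fin 2) ℤ) :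
    Function.Injective ((M : Matrix (Fin 2) (Fin 2) ℤ).map (Int.cast : ℤ → ℝ)).mulVec := by
  have h : ((M⁻¹ : GL (Fin 2) ℤ) : Matrix (Fin 2) (Fin 2) ℤ).map (Int.cast : ℤ → ℝ) *
      (M : Matrix (Fin 2) (Fin 2) ℤ).map (Int.cast : ℤ → ℝ) = 1 := by
    refine (Matrix.map_mul (f := Int.castRingHom ℝ)).symm.trans ?_
    rw [Units.inv_mul, Matrix.map_one] <;> simp
  refine Function.LeftInverse.injective
    (g := (((M⁻¹ : GL (Fin 2) ℤ) : Matrix (Fin 2) (Fin 2) ℤ).map (Int.cast : ℤ → ℝ)).mulVec) ?_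
  intro x
  rw [Matrix.mulVec_mulVec, h, Matrix.one_mulVec]

theorem intAff_inv (M : GL (Fin 2) ℤ) (v q : Fin 2 → ℤ) :
    intAff M v (((M⁻¹ : GL (Fin 2) ℤ) : Matrix (Fin 2) (Fin 2) ℤ).mulVec (q - v)) = q := by
  rw [intAff, Matrix.mulVec_mulVec, Units.mul_inv, Matrix.one_mulVec, sub_add_cancel]

/-- Integrality of `M⁻¹` ensures that a lattice point of `Q` comes from a lattice point of `P`, not
merely from a real one. -/
theorem LatticeEquivalent.exists_image_latticePoints {P Q : Set (Fin 2 → ℝ)}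
    (h : LatticeEquivalent P Q) : ∃ M v, latticePoints Q = intAff M v '' latticePoints P := by
  obtain ⟨M, v, rfl⟩ := h
  refine ⟨M, v, ?_⟩
  ext q
  constructor
  · rintro ⟨x, hx, hxq⟩
    refine ⟨_, ?_, intAff_inv M v q⟩
    rw [← intAff_inv M v q, latticePt_intAff] at hxq
    have := mulVec_map_injective M (add_right_cancel hxq)
    rw [this] at hx
    exact hx
  · rintro ⟨p, hp, rfl⟩
    exact ⟨_, hp, (latticePt_intAff M v p).symm⟩

theorem exists_uniAff_intAff (M : GL (Fin 2) ℤ) (v : Fin 2 → ℤ) :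
    ∃ f, UniAff f ∧ ∀ p, toPair (intAff M v p) = f (toPair p) := by
  refine ⟨_, ⟨M 0 0, M 0 1, M 1 0, M 1 1, v 0, v 1, ?_, fun p => rfl⟩, fun p => ?_⟩
  · have := Int.isUnit_iff.1 ((Matrix.isUnit_iff_isUnit_det _).1 M.isUnit)
    rwa [Matrix.det_fin_two] at this
  · simp [toPair, intAff]

theorem UniAff.exists_intAff {f : ℤ × ℤ → ℤ × ℤ} (hf : UniAff f) :
    ∃ M v, ∀ p, toPair (intAff M v p) = f (toPair p) := by
  obtain ⟨a, b, c, d, e, g, h, hf⟩ := hf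
  have hu : IsUnit !![a, b; c, d].det := by
    rw [Matrix.det_fin_two_of]
    exact Int.isUnit_iff.2 h
  obtain ⟨M, hM⟩ := (Matrix.isUnit_iff_isUnit_det _).2 hu
  refine ⟨M, ![e, g], fun p => ?_⟩
  rw [hf, intAff, hM]
  simp [toPair, dotProduct, Fin.sum_univ_two]

/-- Affine maps commute with convex hulls. -/
theorem UniEquiv.latticeEquivalent {S T : Finset (ℤ × ℤ)} (h : UniEquiv S T) :
    LatticeEquivalent (polygonOf S) (polygonOf T) := by
  obtain ⟨f, hf, rfl⟩ := h
  obtain ⟨M, v, hM⟩ := hf.exists_intAff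
  refine ⟨M, v, ?_⟩
  have := AffineMap.image_convexHull
    (((Matrix.toLin' ((M : Matrix (Fin 2) (Fin 2) ℤ).map (Int.cast : ℤ → ℝ))).toAffineMap +
      AffineMap.const ℝ (Fin 2 → ℝ) (latticePt v))) (latticePt '' {p | toPair p ∈ S})
  rw [polygonOf, polygonOf]
  refine this.trans ?_
  congr 1
  rw [Set.image_image]
  ext y
  constructor
  · rintro ⟨p, hp, rfl⟩
    refine ⟨intAff M v p, ?_, latticePt_intAff M v p⟩
    rw [Set.mem_ofPred_eq, hM]
    exact Finset.mem_image_of_mem f hp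
  · rintro ⟨q, hq, rfl⟩
    obtain ⟨x, hx, hxq⟩ := Finset.mem_image.1 hq
    refine ⟨![x.1, x.2], hx, ?_⟩
    have hq' : q = intAff M v ![x.1, x.2] := toPair_injective (by rw [hM, ← hxq]; rfl)
    rw [hq', latticePt_intAff]
    rfl

/-- The convex hull of a list of points. -/
abbrev polygon (R : List (ℕ × ℕ)) : Set (Fin 2 → ℝ) := polygonOf (pts R)

theorem coord_mem_of_mem_polygon {R : List (ℕ × ℕ)} {m : ℕ} (hm : ∀ r ∈ R, r.1 ≤ m ∧ r.2 ≤ m)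
    {y : Fin 2 → ℝ} (hy : y ∈ polygon R) (i : Fin 2) : 0 ≤ y i ∧ y i ≤ m := by
  have hb : ∀ x ∈ pts R, 0 ≤ x.1 ∧ 0 ≤ x.2 ∧ x.1 ≤ m ∧ x.2 ≤ m := fun x hx => by
    obtain ⟨r, hr, rfl⟩ := mem_pts.1 hx
    have := hm r hr
    simp only [toZ]
    omega
  have h1 := halfPlane_of_mem_polygonOf (u := 1) (w := 0) (k := 0)
    (fun x hx => by have := hb x hx; omega) hy
  have h2 := halfPlane_of_mem_polygonOf (u := 0) (w := 1) (k := 0)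
    (fun x hx => by have := hb x hx; omega) hy
  have h3 := halfPlane_of_mem_polygonOf (u := -1) (w := 0) (k := m)
    (fun x hx => by have := hb x hx; omega) hy
  have h4 := halfPlane_of_mem_polygonOf (u := 0) (w := -1) (k := m)
    (fun x hx => by have := hb x hx; omega) hy
  push_cast at h1 h2 h3 h4
  fin_cases i <;> constructor <;> simp only [Fin.mk_zero, Fin.mk_one] <;> linarith

/-- The polygon lies in `[0, 7]²`, and `hullCheck` separates each unlisted grid point from it by an
edge. For the segment, whose ends no edge cuts off, the square itself does this. -/
theorem latticePoints_polygon {R : List (ℕ × ℕ)} (hm : ∀ r ∈ R, r.1 ≤ 7 ∧ r.2 ≤ 7)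
    (hR : hullCheck R = true) (p : Fin 2 → ℤ) :
    p ∈ latticePoints (polygon R) ↔ toPair p ∈ pts R := by
  refine ⟨fun hp => ?_, mem_latticePoints_polygonOf⟩
  have hc := coord_mem_of_mem_polygon hm hp
  have h0 := hc 0
  have h1 := hc 1
  simp only [latticePt] at h0 h1
  norm_cast at h0 h1
  obtain ⟨v, hv⟩ : ∃ v : ℕ × ℕ, toZ v = toPair p :=
    ⟨((p 0).toNat, (p 1).toNat), by ext <;> simp only [toZ, toPair] <;> omega⟩
  simp only [hullCheck, List.all_eq_true, mem_grid, Bool.or_eq_true, List.any_eq_true,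
    List.contains_eq_mem, decide_eq_true_eq] at hR
  have hv7 : v.1 ≤ 7 ∧ v.2 ≤ 7 := by
    simp only [toZ, toPair, Prod.mk.injEq] at hv
    omega
  rcases hR v hv7 with ⟨e, he, hlt⟩ | hmem
  · exfalso
    obtain ⟨-, -, -, hleft⟩ := mem_edges he
    have hpos := halfPlane_of_mem_polygonOf (u := (e.1.2 : ℤ) - e.2.2) (w := (e.2.1 : ℤ) - e.1.1)
      (k := -((e.1.2 : ℤ) - e.2.2) * e.1.1 - ((e.2.1 : ℤ) - e.1.1) * e.1.2)
      (fun x hx => by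
        have := hleft x hx
        simp only [area, toZ] at this
        linear_combination this) hp
    simp only [latticePt] at hpos
    have hpos' : 0 ≤ ((e.1.2 : ℤ) - e.2.2) * p 0 + ((e.2.1 : ℤ) - e.1.1) * p 1 +
        (-((e.1.2 : ℤ) - e.2.2) * e.1.1 - ((e.2.1 : ℤ) - e.1.1) * e.1.2) := by
      exact_mod_cast hpos
    have harea : 0 ≤ area (toZ e.1) (toZ e.2) (toZ v) := by
      rw [hv]
      simp only [area, toZ, toPair]
      linear_combination hpos'
    rw [area_toZ] at harea
    rw [Nat.blt_eq] at hlt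
    omega
  · rw [← hv]
    exact mem_pts.2 ⟨v, hmem, rfl⟩

theorem ncard_latticePoints_polygon {R : List (ℕ × ℕ)} (hn : R.Nodup)
    (hm : ∀ r ∈ R, r.1 ≤ 7 ∧ r.2 ≤ 7) (hR : hullCheck R = true) :
    (latticePoints (polygon R)).ncard = R.length := by
  have : toPair '' latticePoints (polygon R) = pts R := by
    ext x
    constructor
    · rintro ⟨p, hp, rfl⟩
      exact (latticePoints_polygon hm hR p).1 hp
    · exact fun hx => ⟨![x.1, x.2], (latticePoints_polygon hm hR _).2 hx, rfl⟩
  rw [← Set.ncard_image_of_injective _ toPair_injective, this, Set.ncard_coe_finset, card_pts hn]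

theorem LatticeEquivalent.uniEquiv {R R' : List (ℕ × ℕ)}
    (hm : ∀ r ∈ R, r.1 ≤ 7 ∧ r.2 ≤ 7) (hR : hullCheck R = true)
    (hm' : ∀ r ∈ R', r.1 ≤ 7 ∧ r.2 ≤ 7) (hR' : hullCheck R' = true)
    (h : LatticeEquivalent (polygon R) (polygon R')) : UniEquiv (pts R) (pts R') := by
  obtain ⟨M, v, hMv⟩ := h.exists_image_latticePoints
  obtain ⟨f, hf, hfM⟩ := exists_uniAff_intAff M v
  refine ⟨f, hf, ?_⟩
  ext x
  have hx := latticePoints_polygon hm' hR' ![x.1, x.2]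
  rw [toPair_vec, hMv] at hx
  rw [← hx, Finset.mem_image]
  constructor
  · rintro ⟨y, hy, hyx⟩
    refine ⟨![y.1, y.2], (latticePoints_polygon hm hR _).2 hy, toPair_injective ?_⟩
    rw [hfM, toPair_vec, toPair_vec, hyx]
  · rintro ⟨p, hp, hpx⟩
    refine ⟨toPair p, (latticePoints_polygon hm hR _).1 hp, ?_⟩
    rw [← hfM, hpx, toPair_vec]

/-! ### Toric codes and characters of the torus. -/

section Codes

variable {F : Type*} [Field F]

/-- Evaluation of a monomial, as a character of the torus. -/
def evalHom (F : Type*) [Field F] (p : Fin 2 → ℤ) : (Fin 2 → Fˣ) →* F where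
  toFun := evalMonomial F p
  map_one' := by simp [evalMonomial]
  map_mul' a b := by simp [evalMonomial, mul_zpow, Finset.prod_mul_distrib]

theorem mem_latticePoints_bounds {q : ℕ} {P : Set (Fin 2 → ℝ)} (hP : P ⊆ box q)
    {p : Fin 2 → ℤ} (hp : p ∈ latticePoints P) (i : Fin 2) : 0 ≤ p i ∧ p i ≤ (q : ℤ) - 2 := by
  have := hP hp i
  simp only [latticePt] at this
  exact_mod_cast this

theorem finite_latticePoints {q : ℕ} {P : Set (Fin 2 → ℝ)} (hP : P ⊆ box q) :
    (latticePoints P).Finite :=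
  (Set.finite_Icc (fun _ => (0 : ℤ)) (fun _ => (q : ℤ) - 2)).subset fun _ hp =>
    ⟨fun i => (mem_latticePoints_bounds hP hp i).1, fun i => (mem_latticePoints_bounds hP hp i).2⟩

/-- Monomials with different exponents between `0` and `q - 2` are linearly independent. -/
theorem linearIndependent_evalMonomial [Fintype F] {P : Set (Fin 2 → ℝ)}
    (hP : P ⊆ box (Fintype.card F)) :
    LinearIndependent F (fun p : latticePoints P => evalMonomial F p) := by
  classical
  have hinj : Function.Injective fun p : latticePoints P => evalHom F p := by
    rintro ⟨p, hp⟩ ⟨p', hp'⟩ h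
    obtain ⟨g, hg⟩ := IsCyclic.exists_generator (α := Fˣ)
    have hord : (orderOf g : ℤ) = Fintype.card F - 1 := by
      rw [orderOf_eq_card_of_forall_mem_zpowers hg, Nat.card_eq_fintype_card, Fintype.card_units,
        Nat.cast_sub Fintype.card_pos, Nat.cast_one]
    refine Subtype.ext (funext fun i => ?_)
    -- Evaluating at a generator in coordinate `i` determines `p i` modulo `q - 1`, hence exactly,
    -- since `0 ≤ p i ≤ q - 2`.
    have hi : ∀ p : Fin 2 → ℤ, evalHom F p (Pi.mulSingle i g) = ((g ^ p i : Fˣ) : F) := fun p => by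
      change ((∏ j, (Pi.mulSingle i g : Fin 2 → Fˣ) j ^ p j : Fˣ) : F) = _
      rw [Finset.prod_eq_single i (fun j _ hj => by simp [Pi.mulSingle_eq_of_ne hj]) (by simp),
        Pi.mulSingle_eq_same]
    have h' := DFunLike.congr_fun h (Pi.mulSingle i g)
    simp only [hi] at h'
    have hmod := zpow_eq_zpow_iff_modEq.1 (Units.ext h')
    have b := mem_latticePoints_bounds hP hp i
    have b' := mem_latticePoints_bounds hP hp' i
    rw [hord, Int.ModEq, Int.emod_eq_of_lt b.1 (by omega), Int.emod_eq_of_lt b'.1 (by omega)] at hmod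
    exact hmod
  exact (linearIndependent_monoidHom (Fin 2 → Fˣ) F).comp _ hinj

theorem finrank_toricCode [Fintype F] {P : Set (Fin 2 → ℝ)} (hP : P ⊆ box (Fintype.card F)) :
    Module.finrank F (toricCode F P) = (latticePoints P).ncard := by
  have := (finite_latticePoints hP).fintype
  rw [toricCode, Set.image_eq_range, finrank_span_eq_card (linearIndependent_evalMonomial hP),
    Set.ncard_eq_toFinset_card', Set.toFinset_card]

/-- The map of the torus given by an integral matrix. -/
def torusMap (M : Matrix (Fin 2) (Fin 2) ℤ) (a : Fin 2 → Fˣ) : Fin 2 → Fˣ :=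
  fun j => ∏ i, a i ^ M i j

/-- The order reverses because columns of the matrix serve as exponents; this convention makes `M`
act on exponents by `mulVec`. -/
theorem torusMap_torusMap (M N : Matrix (Fin 2) (Fin 2) ℤ) (a : Fin 2 → Fˣ) :
    torusMap M (torusMap N a) = torusMap (N * M) a := by
  ext j
  simp only [torusMap, Fin.prod_univ_two, Matrix.mul_apply, Fin.sum_univ_two, zpow_add, mul_zpow,
    zpow_mul]
  push_cast
  ring

theorem torusMap_one (a : Fin 2 → Fˣ) : torusMap 1 a = a := by
  refine funext (Fin.forall_fin_two.2 ⟨?_, ?_⟩) <;> simp [torusMap]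

/-- The permutation of the torus given by a unimodular matrix. -/
def torusEquiv (F : Type*) [Field F] (M : GL (Fin 2) ℤ) : Equiv.Perm (Fin 2 → Fˣ) where
  toFun := torusMap (M : Matrix (Fin 2) (Fin 2) ℤ)
  invFun := torusMap ((M⁻¹ : GL (Fin 2) ℤ) : Matrix (Fin 2) (Fin 2) ℤ)
  left_inv a := by rw [torusMap_torusMap, Units.mul_inv, torusMap_one]
  right_inv a := by rw [torusMap_torusMap, Units.inv_mul, torusMap_one]

/-- The linear part permutes evaluation points; the translation contributes a nonzero factor
independent of `p`, which becomes the diagonal matrix. -/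
theorem evalMonomial_intAff (M : GL (Fin 2) ℤ) (v p : Fin 2 → ℤ) (a : Fin 2 → Fˣ) :
    evalMonomial F (intAff M v p) a = evalMonomial F p (torusEquiv F M a) * evalMonomial F v a := by
  simp only [evalMonomial, torusEquiv, Equiv.coe_fn_mk, torusMap, Fin.prod_univ_two, intAff,
    Pi.add_apply, Matrix.mulVec, dotProduct, Fin.sum_univ_two, zpow_add, mul_zpow, zpow_mul]
  push_cast
  ring

theorem intAff_injective (M : GL (Fin 2) ℤ) (v : Fin 2 → ℤ) : Function.Injective (intAff M v) :=
  fun p q h => latticePt_injective <| mulVec_map_injective M <| by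
    have := congrArg latticePt h
    rw [latticePt_intAff, latticePt_intAff] at this
    exact add_right_cancel this

/-- Lattice equivalent polygons in the square `[0, q - 2]²` have monomially equivalent codes. -/
theorem LatticeEquivalent.monomiallyEquivalent [Fintype F] [DecidableEq F]
    {P Q : Set (Fin 2 → ℝ)} (h : LatticeEquivalent P Q) (hP : P ⊆ box (Fintype.card F))
    (hQ : Q ⊆ box (Fintype.card F)) :
    MonomiallyEquivalent (toricCode F P) (toricCode F Q) := by
  obtain ⟨M, v, hMv⟩ := h.exists_image_latticePoints
  have := (finite_latticePoints hP).to_subtype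
  let e := (Finite.equivFin (latticePoints P)).symm
  let e' : Fin (Nat.card (latticePoints P)) → latticePoints Q := fun j =>
    ⟨intAff M v (e j), by rw [hMv]; exact ⟨_, (e j).2, rfl⟩⟩
  have he' : Function.Bijective e' := by
    refine ⟨fun j k hjk => ?_, fun ⟨q, hq⟩ => ?_⟩
    · exact e.injective (Subtype.ext (intAff_injective M v (Subtype.ext_iff.1 hjk)))
    · rw [hMv] at hq
      obtain ⟨p, hp, rfl⟩ := hq
      exact ⟨e.symm ⟨p, hp⟩, Subtype.ext (by simp only [e', Equiv.apply_symm_apply])⟩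
  -- Scaling precedes permuting, so the diagonal entry at `b` is the monomial of `v` at the preimage
  -- of `b` under the torus map.
  refine ⟨Nat.card (latticePoints P), Matrix.of fun j => evalMonomial F (e j),
    Matrix.of fun j => evalMonomial F (e' j), fun b => ∏ i, ((torusEquiv F M).symm b) i ^ v i,
    (torusEquiv F M).symm, ⟨?_, ?_⟩, ⟨?_, ?_⟩, ?_⟩
  · exact (linearIndependent_evalMonomial hP).comp e e.injective
  · rw [toricCode, Set.image_eq_range]
    congr 1
    exact e.surjective.range_comp (fun p : latticePoints P => evalMonomial F p)
  · exact (linearIndependent_evalMonomial hQ).comp e' he'.injective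
  · rw [toricCode, Set.image_eq_range]
    congr 1
    exact he'.surjective.range_comp (fun p : latticePoints Q => evalMonomial F p)
  · rw [Equiv.Perm.permMatrix, PEquiv.mul_toMatrix_toPEquiv]
    ext j a
    rw [Matrix.submatrix_apply, Matrix.mul_diagonal, Equiv.symm_symm]
    simp only [Matrix.of_apply, id, Equiv.symm_apply_apply]
    exact evalMonomial_intAff M v (e j) a

end Codes

/-! ### The 42 representatives and the conclusion. -/

theorem length_polygonsEightAll : polygonsEightAll.length = 42 := by decide

/-- The lattice polygons with eight lattice points, as a sequence. -/
def eightPoints (i : Fin 42) : List (ℕ × ℕ) :=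
  polygonsEightAll.get (i.cast length_polygonsEightAll.symm)

theorem eightPoints_mem (i : Fin 42) : eightPoints i ∈ polygonsEightAll := List.get_mem _ _

theorem hullCheck_of_mem {R : List (ℕ × ℕ)} (hR : R ∈ polygonsEightAll) : hullCheck R = true :=
  List.all_eq_true.1 hullCheck_polygonsEightAll R hR

theorem polygon_subset_box {R : List (ℕ × ℕ)} (hR : R ∈ polygonsEightAll) {q : ℕ} (hq : 9 ≤ q) :
    polygon R ⊆ box q := fun y hy i => by
  have h := coord_mem_of_mem_polygon (length_nodup_polygonsEightAll R hR).2.2 hy i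
  have hq' : (9 : ℝ) ≤ q := by exact_mod_cast hq
  push_cast at h
  exact ⟨h.1, by linarith⟩

/-- A lattice polygon with eight lattice points is equivalent to one of the list. -/
theorem IsLatticePolygon.exists_latticeEquivalent {Q : Set (Fin 2 → ℝ)} (hQ : IsLatticePolygon Q)
    (h : (latticePoints Q).ncard = 8) : ∃ i, LatticeEquivalent Q (polygon (eightPoints i)) := by
  obtain ⟨S, hS, rfl, hcard⟩ :=
    -- Since `ncard` is zero on infinite sets, the value 8 implies finiteness.
    hQ.exists_triClosed (Set.finite_of_ncard_ne_zero (by omega))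
  obtain ⟨R, hR, hSR⟩ := hS.exists_uniEquiv_of_card_eq_eight (hcard.trans h)
  obtain ⟨n, rfl⟩ := List.get_of_mem hR
  exact ⟨n.cast length_polygonsEightAll, hSR.latticeEquivalent⟩

theorem not_latticeEquivalent_polygon {i j : Fin 42} (hij : i ≠ j) :
    ¬ LatticeEquivalent (polygon (eightPoints i)) (polygon (eightPoints j)) := fun h => by
  obtain ⟨-, hn, hm⟩ := length_nodup_polygonsEightAll _ (eightPoints_mem i)
  obtain ⟨-, hn', hm'⟩ := length_nodup_polygonsEightAll _ (eightPoints_mem j)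
  have hinv := (h.uniEquiv hm (hullCheck_of_mem (eightPoints_mem i)) hm'
    (hullCheck_of_mem (eightPoints_mem j))).invariant_eq hn hn'
  have hinj := List.inj_on_of_nodup_map nodup_map_invariant (eightPoints_mem i)
    (eightPoints_mem j) hinv
  refine hij (Fin.cast_injective length_polygonsEightAll.symm ?_)
  exact List.nodup_iff_injective_get.1 (List.Nodup.of_map _ nodup_map_invariant) hinj

end ToricSurface

theorem mainTheorem4 :
    ∃ P : Fin 42 → Set (Fin 2 → ℝ),
      -- the `P i` represent all lattice-equivalence classes of lattice polygons with 8
      -- lattice points, each class exactly once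
      (∀ i, ToricSurface.IsLatticePolygon (P i) ∧ (ToricSurface.latticePoints (P i)).ncard = 8) ∧
      (∀ i j, i ≠ j → ¬ ToricSurface.LatticeEquivalent (P i) (P j)) ∧
      (∀ Q : Set (Fin 2 → ℝ), ToricSurface.IsLatticePolygon Q →
        (ToricSurface.latticePoints Q).ncard = 8 →
          ∃ i, ToricSurface.LatticeEquivalent Q (P i)) ∧
      -- every toric surface code of dimension 8 over a sufficiently large finite field is
      -- monomially equivalent to the toric code of one of the `P i`
      ∃ q₀ : ℕ, ∀ (F : Type*) [Field F] [Fintype F] [DecidableEq F], q₀ ≤ Fintype.card F →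
        (∀ i, P i ⊆ ToricSurface.box (Fintype.card F)) ∧
        ∀ C : Submodule F ((Fin 2 → Fˣ) → F),
          ToricSurface.IsToricSurfaceCode F C → Module.finrank F C = 8 →
            ∃ i, ToricSurface.MonomiallyEquivalent C (ToricSurface.toricCode F (P i)) := by
  refine ⟨fun i => ToricSurface.polygon (ToricSurface.eightPoints i), fun i => ?_,
    fun i j => ToricSurface.not_latticeEquivalent_polygon,
    -- The representatives have coordinates at most 7, so `7 ≤ q - 2` is enough.
    fun Q hQ h => hQ.exists_latticeEquivalent h, 9, fun F _ _ _ hq => ?_⟩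
  · have hR := ToricSurface.eightPoints_mem i
    obtain ⟨hl, hn, hm⟩ := ToricSurface.length_nodup_polygonsEightAll _ hR
    have hcard := ToricSurface.ncard_latticePoints_polygon hn hm (ToricSurface.hullCheck_of_mem hR)
    refine ⟨ToricSurface.isLatticePolygon_polygonOf ?_, hcard.trans hl⟩
    rw [← Finset.card_pos, ToricSurface.card_pts hn, hl]
    norm_num
  · have hbox := fun i => ToricSurface.polygon_subset_box (ToricSurface.eightPoints_mem i) hq
    refine ⟨hbox, ?_⟩
    rintro C ⟨P, hP, hPbox, rfl⟩ hdim
    rw [ToricSurface.finrank_toricCode hPbox] at hdim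
    obtain ⟨i, hi⟩ := hP.exists_latticeEquivalent hdim
    exact ⟨i, hi.monomiallyEquivalent hPbox (hbox i)⟩
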